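/- For a commutative ring $R$ and $n\in\mathbb{N}$ let $\Sigma^n R^2=\{x_1^2+\cdots+x_n^2 \mid x_1,\ldots,x_n\in R\}$, and define the Pythagoras number of $R$ as \[P(R)=\inf\{n\in\mathbb{N} \mid \Sigma^n R^2=\Sigma^{n+1}R^2\}\in\mathbb{N}\cup\{\infty\},\] where the infimum of the empty set is $\infty$. For $N\ge 1$ let $\zeta_N=e^{2\pi i/N}\in\mathbb{C}$ and $K_N^+=\mathbb{Q}(\zeta_N+\zeta_N^{-1})$, and for a prime number $p$ let $K_{p^\infty}^+=\bigcup_{n\in\mathbb{N}}K_{p^n}^+$, with ring of integers (the integral closure of $\mathbb{Z}$) $\mathcal{O}_{K_{p^\infty}^+}$. **Theorem.** Let $p$ be a prime number with $p\equiv 1\pmod 4$. Then $P(\mathcal{O}_{K_{p^\infty}^+})=\infty$. -/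

import Mathlib

open scoped NumberField

/-- The set of sums of `n` squares of elements of a commutative ring `R`. -/
def sumsOfSquares (R : Type*) [CommRing R] (n : ℕ) : Set R :=
  {a | ∃ x : Fin n → R, a = ∑ i, x i ^ 2}

/-- The Pythagoras number of a commutative ring: the infimum, in the extended natural numbers, of
all natural numbers `n` such that every sum of `n + 1` squares is a sum of `n` squares and
conversely. The infimum of the empty set is `⊤`, that is, infinity. -/
noncomputable def pythagorasNumber (R : Type*) [CommRing R] : ℕ∞ :=
  sInf {N : ℕ∞ | ∃ n : ℕ, N = n ∧ sumsOfSquares R n = sumsOfSquares R (n + 1)}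

/-- The complex number `exp (2 π i / N)`, a primitive `N`-th root of unity for `N ≥ 1`. -/
noncomputable def zetaRoot (N : ℕ) : ℂ :=
  Complex.exp (2 * Real.pi * Complex.I / N)

/-- The field generated over the rational numbers by `ζ + ζ⁻¹`, where `ζ = exp (2 π i / N)`:
the maximal real subfield of the `N`-th cyclotomic field. -/
noncomputable def realCyclotomicField (N : ℕ) : IntermediateField ℚ ℂ :=
  IntermediateField.adjoin ℚ {zetaRoot N + (zetaRoot N)⁻¹}

/-- The supremum of the maximal real subfields of the `p ^ n`-th cyclotomic fields, for all `n`.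
For `p ≠ 0` these form an increasing chain, so that this is their union, see
`coe_realCyclotomicTower`. -/
noncomputable def realCyclotomicTower (p : ℕ) : IntermediateField ℚ ℂ :=
  ⨆ n : ℕ, realCyclotomicField (p ^ n)

theorem realCyclotomicField_mono_pow (p : ℕ) (hp : p ≠ 0) :
    Monotone fun n : ℕ => realCyclotomicField (p ^ n) := by
  refine monotone_nat_of_le_succ fun n => ?_
  have hz : zetaRoot (p ^ (n + 1)) ^ p = zetaRoot (p ^ n) := by
    have hp' : (p : ℂ) ≠ 0 := by exact_mod_cast hp
    unfold zetaRoot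
    rw [← Complex.exp_nat_mul]
    congr 1
    rw [Nat.cast_pow, Nat.cast_pow, pow_succ]
    field_simp
  have h0 : zetaRoot (p ^ (n + 1)) * (zetaRoot (p ^ (n + 1)))⁻¹ = 1 :=
    mul_inv_cancel₀ (Complex.exp_ne_zero _)
  simp only [realCyclotomicField]
  have hd : Polynomial.dickson 1 (1 : ℂ) p =
      (Polynomial.dickson 1 (1 : ℚ) p).map (algebraMap ℚ ℂ) := by
    rw [Polynomial.map_dickson, map_one]
  rw [IntermediateField.adjoin_le_iff, Set.singleton_subset_iff, ← hz, ← inv_pow,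
    ← Polynomial.dickson_one_one_eval_add_inv _ _ h0 p, hd, Polynomial.eval_map_algebraMap]
  exact IntermediateField.algebra_adjoin_le_adjoin _ _ (Polynomial.aeval_mem_adjoin_singleton ℚ _)

/-- The field `realCyclotomicTower p` is the union of its finite layers. -/
theorem coe_realCyclotomicTower (p : ℕ) (hp : p ≠ 0) :
    (realCyclotomicTower p : Set ℂ) = ⋃ n : ℕ, (realCyclotomicField (p ^ n) : Set ℂ) :=
  IntermediateField.coe_iSup_of_directed (realCyclotomicField_mono_pow p hp).directed_le

/-! For rapidly growing exponents w, the sum α of the n+1 squares (ζ^w + ζ^(-w))^2 is not a sum of n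
squares anywhere in the tower. Let q : G → Q be reduction from ℤ/p^(s+1) to ℤ/p^s. Then ℤ[ζ] is ℤ[G]
modulo the functions constant on the fibres of q (`charSum_stdAddChar_eq_zero_iff`), and α = ∑
(e(b)^2 + 1) over all b = ±w. Suppose α = ∑ y_j^2 and lift each y_j to f_j in ℤ[G].

As the y_j are real, α is also the sum of y_j times its conjugate. Comparing coefficients on ker q
gives the total variance of the f_j along fibres (`sum_sum_sq_sub_eq`), so at most as many pairs (j,
C) as there are b's have f_j nonconstant on the fibre C. Modulo 2, f * f at 2g is f(g)^2, which
forces some f_j to be nonconstant on the fibre of each q(b) (`exists_fiberCharSum_ne_zero`). Hence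
these pairs are exactly (J b, q b).

If J w = J w' with w ≠ w', the part of ∑ y_j^2 over q(w) + q(w') is a nonzero product 2uv, while α
has nothing there (`exists_separating_map`). So J is injective on the positive exponents. -/

/-! ### Integral group rings and their character values -/

section CharacterSums

variable {G Q : Type*} [AddCommGroup G] [Fintype G] [AddCommGroup Q]

/-- The value of the integral group ring element `f` under the additive character `e`. -/
noncomputable def charSum (e : AddChar G ℂ) (f : G → ℤ) : ℂ := ∑ g, (f g : ℂ) * e g

/-- The product of two elements of the integral group ring. -/
def groupConv (f f' : G → ℤ) (g : G) : ℤ := ∑ a, f a * f' (g - a)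

theorem charSum_groupConv (e : AddChar G ℂ) (f f' : G → ℤ) :
    charSum e (groupConv f f') = charSum e f * charSum e f' := by
  rw [mul_comm (charSum e f)]
  simp only [charSum, groupConv, Int.cast_sum, Int.cast_mul, Finset.sum_mul, Finset.mul_sum]
  rw [Finset.sum_comm]
  refine Finset.sum_congr rfl fun a _ => ?_
  rw [← Equiv.sum_comp (Equiv.addLeft a)]
  refine Finset.sum_congr rfl fun b _ => ?_
  simp only [Equiv.coe_addLeft, add_sub_cancel_left, AddChar.map_add_eq_mul]
  ring

theorem charSum_sum {ι : Type*} (s : Finset ι) (e : AddChar G ℂ) (f : ι → G → ℤ) :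
    charSum e (fun g => ∑ i ∈ s, f i g) = ∑ i ∈ s, charSum e (f i) := by
  simp only [charSum, Int.cast_sum, Finset.sum_mul]
  rw [Finset.sum_comm]

theorem charSum_add (e : AddChar G ℂ) (f f' : G → ℤ) :
    charSum e (fun g => f g + f' g) = charSum e f + charSum e f' := by
  simp only [charSum, Int.cast_add, add_mul, Finset.sum_add_distrib]

theorem charSum_sub (e : AddChar G ℂ) (f f' : G → ℤ) :
    charSum e (fun g => f g - f' g) = charSum e f - charSum e f' := by
  simp only [charSum, Int.cast_sub, sub_mul, Finset.sum_sub_distrib]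

theorem charSum_ite_eq [DecidableEq G] (e : AddChar G ℂ) (a : G) :
    charSum e (fun g => if g = a then 1 else 0) = e a := by
  simp [charSum]

theorem conj_charSum (e : AddChar G ℂ) (f : G → ℤ) :
    (starRingEnd ℂ) (charSum e f) = charSum e (fun g => f (-g)) := by
  simp only [charSum, map_sum, map_mul, map_intCast]
  rw [← Equiv.sum_comp (Equiv.neg G)]
  refine Finset.sum_congr rfl fun a _ => ?_
  simp [AddChar.map_neg_eq_conj]

/-- A group ring element times itself, at a double, is congruent to a square modulo two. -/
theorem groupConv_self_two_nsmul (h2 : ∀ g : G, g + g = 0 → g = 0) (f : G → ℤ) (g : G) :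
    ((groupConv f f (g + g) : ℤ) : ZMod 2) = ((f g ^ 2 : ℤ) : ZMod 2) := by
  classical
  rw [groupConv, ← Finset.add_sum_erase _ _ (Finset.mem_univ g)]
  -- The involution a ↦ 2g - a fixes only g; the remaining terms cancel in equal pairs.
  have : ∑ a ∈ Finset.univ.erase g, ((f a * f (g + g - a) : ℤ) : ZMod 2) = 0 := by
    refine Finset.sum_involution (fun a _ => g + g - a) ?_ ?_ ?_ ?_
    · intro a _
      rw [sub_sub_cancel, mul_comm (f (g + g - a))]
      exact CharTwo.add_self_eq_zero _
    · intro a ha _ h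
      refine Finset.ne_of_mem_erase ha (sub_eq_zero.1 (h2 _ ?_))
      calc a - g + (a - g) = a - (g + g - a) := by abel
        _ = 0 := by rw [h, sub_self]
    · intro a ha
      refine Finset.mem_erase.2 ⟨fun h => Finset.ne_of_mem_erase ha ?_, Finset.mem_univ _⟩
      have : g + g - (g + g - a) = g + g - g := by rw [h]
      simpa using this
    · intro a _
      exact sub_sub_cancel _ _
  rw [Int.cast_add, Int.cast_sum, this, add_zero, add_sub_cancel_right, sq]

/-- A nonconstant integral function on a finite set has large variance. -/
theorem two_mul_card_sub_one_le_sum_sq {α : Type*} (s : Finset α) (f : α → ℤ) {a b : α}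
    (ha : a ∈ s) (hb : b ∈ s) (hab : f a ≠ f b) :
    2 * ((s.card : ℤ) - 1) ≤ ∑ x ∈ s, ∑ y ∈ s, (f x - f y) ^ 2 := by
  classical
  set t := s.filter fun x => f x = f a with ht
  set u := s.filter fun x => ¬ f x = f a with hu
  have hcard : t.card + u.card = s.card := Finset.card_filter_add_card_filter_not _
  have htpos : 0 < t.card := Finset.card_pos.2 ⟨a, by simp [ht, ha]⟩
  have hupos : 0 < u.card := Finset.card_pos.2 ⟨b, by simp [hu, hb, hab.symm]⟩
  -- Each of the 2|t||u| ordered pairs split between t and u contributes at least 1; conclude by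
  -- (|t| - 1)(|u| - 1) ≥ 0.
  have key : ∑ x ∈ s, ∑ y ∈ s, ((if f x = f a then 1 else 0) * (if ¬ f y = f a then 1 else 0) +
      (if ¬ f x = f a then 1 else 0) * (if f y = f a then 1 else 0) : ℤ) ≤
      ∑ x ∈ s, ∑ y ∈ s, (f x - f y) ^ 2 := by
    refine Finset.sum_le_sum fun x _ => Finset.sum_le_sum fun y _ => ?_
    by_cases hx : f x = f a <;> by_cases hy : f y = f a <;> simp only [hx, hy]
    · simp
    · simpa using Int.one_le_abs (sub_ne_zero.2 (Ne.symm hy))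
    · simpa using Int.one_le_abs (sub_ne_zero.2 hx)
    · simpa using sq_nonneg _
  simp only [Finset.sum_add_distrib, ← Finset.sum_mul_sum, Finset.sum_boole] at key
  rw [← ht, ← hu] at key
  zify at hcard htpos hupos
  nlinarith [mul_nonneg (sub_nonneg.2 (Int.add_one_le_iff.2 htpos))
    (sub_nonneg.2 (Int.add_one_le_iff.2 hupos))]

variable [DecidableEq Q]

/-- The part of a group ring element supported on a fibre of `q`, under the character `e`. -/
noncomputable def fiberCharSum (q : G →+ Q) (e : AddChar G ℂ) (f : G → ℤ) (C : Q) : ℂ :=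
  charSum e fun g => if q g = C then f g else 0

theorem fiberCharSum_eq_zero_iff {q : G →+ Q} {e : AddChar G ℂ}
    (hker : ∀ f : G → ℤ, charSum e f = 0 ↔ ∀ x y, q x = q y → f x = f y) (f : G → ℤ) (C : Q) :
    fiberCharSum q e f C = 0 ↔ ∀ x y, q x = C → q y = C → f x = f y := by
  rw [fiberCharSum, hker]
  constructor
  · intro h x y hx hy
    simpa [hx, hy] using h x y (hx.trans hy.symm)
  · intro h x y hxy
    by_cases hy : q y = C
    · simp [hxy, hy, h x y (hxy.trans hy) hy]
    · simp [hxy, hy]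

/-- The group ring is graded by Q through q, and convolution respects the grading. -/
theorem fiberCharSum_groupConv [Fintype Q] (q : G →+ Q) (e : AddChar G ℂ) (f f' : G → ℤ) (D : Q) :
    fiberCharSum q e (groupConv f f') D =
      ∑ C, fiberCharSum q e f C * fiberCharSum q e f' (D - C) := by
  simp only [fiberCharSum, ← charSum_groupConv, ← charSum_sum]
  congr 1
  ext g
  simp only [groupConv]
  rw [Finset.sum_comm]
  simp only [ite_mul, zero_mul, Finset.sum_ite_eq, Finset.mem_univ, if_true, map_sub,
    sub_left_inj]
  split_ifs <;> simp

/-- The total variance of `f` on the fibres of `q`. -/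
theorem sum_sq_sub_eq_groupConv (q : G →+ Q) (f : G → ℤ) :
    ∑ a, ∑ b with q b = q a, (f a - f b) ^ 2 =
      2 * ∑ k with q k = 0, (groupConv f (fun g => f (-g)) 0 -
        groupConv f (fun g => f (-g)) k) := by
  have h1 : ∑ k with q k = 0, (groupConv f (fun g => f (-g)) 0 -
      groupConv f (fun g => f (-g)) k) = ∑ a, ∑ b with q b = q a, f a * (f a - f b) := by
    simp only [groupConv, ← Finset.sum_sub_distrib]
    rw [Finset.sum_comm]
    refine Finset.sum_congr rfl fun a _ => ?_
    rw [Finset.sum_filter, Finset.sum_filter, ← Equiv.sum_comp (Equiv.subLeft a)]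
    refine Finset.sum_congr rfl fun b _ => ?_
    simp only [Equiv.subLeft_apply, map_sub, sub_eq_zero, zero_sub, neg_neg, sub_sub_cancel_left,
      eq_comm (a := q a)]
    split_ifs <;> ring
  -- Swapping a and b symmetrises the sum into half the variance.
  have h2 : ∑ a, ∑ b with q b = q a, f a * (f a - f b) =
      ∑ a, ∑ b with q b = q a, f b * (f b - f a) := by
    simp only [Finset.sum_filter]
    rw [Finset.sum_comm]
    simp only [eq_comm]
  rw [h1, two_mul]
  nth_rw 2 [h2]
  simp only [← Finset.sum_add_distrib]
  refine Finset.sum_congr rfl fun a _ => Finset.sum_congr rfl fun b _ => ?_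
  ring

end CharacterSums

/-! ### Sums of squares lifted to the group ring -/

section Representations

variable {G Q : Type*} [AddCommGroup G] [AddCommGroup Q] [DecidableEq G]

/-- The group ring element `∑ i, ([2 b i] + [0])`. -/
def doublesPlusCard {ι : Type*} [Fintype ι] (b : ι → G) (g : G) : ℤ :=
  ∑ i, ((if g = b i + b i then 1 else 0) + if g = 0 then 1 else 0)

theorem doublesPlusCard_eq_zero {ι : Type*} [Fintype ι] {b : ι → G} {g : G} (h0 : g ≠ 0)
    (h : ∀ i, g ≠ b i + b i) : doublesPlusCard b g = 0 :=
  Finset.sum_eq_zero fun i _ => by simp [h0, h i]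

theorem doublesPlusCard_of_map_eq_zero {ι : Type*} [Fintype ι] {q : G →+ Q} {b : ι → G}
    {k : G}
    (hb0 : ∀ i, q (b i) + q (b i) ≠ 0) (hk : q k = 0) :
    doublesPlusCard b k = if k = 0 then (Fintype.card ι : ℤ) else 0 := by
  have h : ∀ i, k ≠ b i + b i := fun i hki => hb0 i (by rw [← map_add, ← hki, hk])
  split_ifs with h0
  · subst h0
    simp [doublesPlusCard, h]
  · exact doublesPlusCard_eq_zero h0 h

variable [Fintype G]

theorem charSum_doublesPlusCard {ι : Type*} [Fintype ι] (e : AddChar G ℂ) (b : ι → G) :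
    charSum e (doublesPlusCard b) = ∑ i, (e (b i) ^ 2 + 1) := by
  unfold doublesPlusCard
  rw [charSum_sum]
  refine Finset.sum_congr rfl fun i _ => ?_
  rw [charSum_add, charSum_ite_eq, charSum_ite_eq, AddChar.map_add_eq_mul, AddChar.map_zero_eq_one,
    sq]

variable [DecidableEq Q] {q : G →+ Q} {e : AddChar G ℂ}

/-- The total variance of the summands in a sum of squares representation. -/
theorem sum_sum_sq_sub_eq {p : ℕ}
    (hker : ∀ f : G → ℤ, charSum e f = 0 ↔ ∀ x y, q x = q y → f x = f y)
    (hfib : ∀ C : Q, (Finset.univ.filter fun g => q g = C).card = p)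
    {ι : Type*} [Fintype ι] {b : ι → G} (hb0 : ∀ i, q (b i) + q (b i) ≠ 0) {r : ℕ}
    {f : Fin r → G → ℤ} (hreal : ∀ j, (starRingEnd ℂ) (charSum e (f j)) = charSum e (f j))
    (hsum : ∑ j, charSum e (f j) ^ 2 = ∑ i, (e (b i) ^ 2 + 1)) :
    ∑ j, ∑ x, ∑ y with q y = q x, (f j x - f j y) ^ 2 =
      2 * (((p : ℤ) - 1) * Fintype.card ι) := by
  have hF : ∀ x y, q x = q y →
      ∑ j, groupConv (f j) (fun g => f j (-g)) x - doublesPlusCard b x =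
        ∑ j, groupConv (f j) (fun g => f j (-g)) y - doublesPlusCard b y := by
    refine (hker fun g => ∑ j, groupConv (f j) (fun g => f j (-g)) g - doublesPlusCard b g).1 ?_
    rw [charSum_sub, charSum_sum, charSum_doublesPlusCard, ← hsum, sub_eq_zero]
    refine Finset.sum_congr rfl fun j _ => ?_
    rw [charSum_groupConv, ← conj_charSum, hreal, sq]
  simp only [sum_sq_sub_eq_groupConv, ← Finset.mul_sum]
  rw [Finset.sum_comm]
  congr 1
  have hk : ∀ k ∈ Finset.univ.filter fun k => q k = 0,
      ∑ j, (groupConv (f j) (fun g => f j (-g)) 0 - groupConv (f j) (fun g => f j (-g)) k) =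
        Fintype.card ι - if k = 0 then (Fintype.card ι : ℤ) else 0 := by
    intro k hk
    have hk := (Finset.mem_filter.1 hk).2
    have h1 := hF 0 k (by rw [hk, map_zero])
    rw [doublesPlusCard_of_map_eq_zero hb0 hk,
      doublesPlusCard_of_map_eq_zero hb0 (map_zero q), if_pos rfl] at h1
    rw [Finset.sum_sub_distrib]
    linarith
  rw [Finset.sum_congr rfl hk, Finset.sum_sub_distrib, Finset.sum_const, hfib,
    Finset.sum_ite_eq' , if_pos (by simp)]
  simp only [nsmul_eq_mul]
  ring

/-- Every fibre of a doubled element meets the support of some summand. -/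
theorem exists_fiberCharSum_ne_zero
    (hker : ∀ f : G → ℤ, charSum e f = 0 ↔ ∀ x y, q x = q y → f x = f y)
    {k : G} (hk : q k = 0) (hk0 : k ≠ 0)
    (h2G : ∀ g : G, g + g = 0 → g = 0) (h2Q : ∀ g : Q, g + g = 0 → g = 0)
    {ι : Type*} [Fintype ι] {b : ι → G} (hb : Function.Injective fun i => q (b i))
    (hb0 : ∀ i, q (b i) ≠ 0) {r : ℕ} {f : Fin r → G → ℤ}
    (hF : ∀ x y, q x = q y → ∑ j, groupConv (f j) (f j) x - doublesPlusCard b x =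
      ∑ j, groupConv (f j) (f j) y - doublesPlusCard b y) (i : ι) :
    ∃ j, fiberCharSum q e (f j) (q (b i)) ≠ 0 := by
  classical
  by_contra! hcon
  simp only [fiberCharSum_eq_zero_iff hker] at hcon
  have hdbl : ∀ i', q (b i) + q (b i) = q (b i') + q (b i') → i = i' := by
    intro i' h
    refine hb (sub_eq_zero.1 (h2Q _ ?_))
    calc q (b i) - q (b i') + (q (b i) - q (b i'))
        = q (b i) + q (b i) - (q (b i') + q (b i')) := by abel
      _ = 0 := by rw [h, sub_self]
  -- The points 2b_i and 2(b_i + k) share a fibre but have coefficients 1 and 0. Modulo 2 the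
  -- convolutions agree at them if every f_j is constant on the fibre of b_i, giving 1 = 0.
  have h1 : doublesPlusCard b (b i + b i) = 1 := by
    have h0 : b i + b i ≠ 0 := fun h => hb0 i (by rw [h2G _ h, map_zero])
    rw [doublesPlusCard, Finset.sum_eq_single i]
    · simp [h0]
    · intro i' _ hi
      have : b i + b i ≠ b i' + b i' :=
        fun h => hi (hdbl i' (by rw [← map_add, h, map_add])).symm
      simp [h0, this]
    · simp
  have h2 : doublesPlusCard b ((b i + k) + (b i + k)) = 0 := by
    refine doublesPlusCard_eq_zero (fun h => hb0 i ?_) fun i' h => ?_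
    · have := congrArg q (h2G _ h)
      simpa [hk] using this
    · have hi : i = i' := hdbl i' (by simpa [hk] using congrArg q h)
      subst hi
      refine hk0 (h2G k ?_)
      have : b i + b i + (k + k) = b i + b i := by rwa [add_add_add_comm] at h
      simpa using this
  have h3 := hF (b i + b i) ((b i + k) + (b i + k)) (by simp [hk])
  rw [h1, h2] at h3
  have h4 := congrArg (Int.cast : ℤ → ZMod 2) h3
  simp only [Int.cast_sub, Int.cast_sum, groupConv_self_two_nsmul h2G] at h4
  rw [Finset.sum_congr rfl fun j _ => by
    rw [hcon j (b i) (b i + k) rfl (by simp [hk])]] at h4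
  simp at h4

/-- In a representation of `∑ i, (e (b i) ^ 2 + 1)` as a sum of squares, independent elements of
the family `b` have to be distributed over different summands. -/
theorem exists_separating_map [Fintype Q] {p : ℕ}
    (hker : ∀ f : G → ℤ, charSum e f = 0 ↔ ∀ x y, q x = q y → f x = f y)
    (hfib : ∀ C : Q, (Finset.univ.filter fun g => q g = C).card = p) (hp : 1 < p)
    (h2G : ∀ g : G, g + g = 0 → g = 0) (h2Q : ∀ g : Q, g + g = 0 → g = 0)
    {ι : Type*} [Fintype ι] {b : ι → G} (hb : Function.Injective fun i => q (b i))
    (hb0 : ∀ i, q (b i) ≠ 0) {r : ℕ} {f : Fin r → G → ℤ}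
    (hreal : ∀ j, (starRingEnd ℂ) (charSum e (f j)) = charSum e (f j))
    (hsum : ∑ j, charSum e (f j) ^ 2 = ∑ i, (e (b i) ^ 2 + 1)) :
    ∃ J : ι → Fin r, ∀ i i', i ≠ i' → q (b i) + q (b i') ≠ 0 →
      (∀ k l, q (b k) + q (b l) = q (b i) + q (b i') → (k = i ∧ l = i') ∨ (k = i' ∧ l = i)) →
        J i ≠ J i' := by
  classical
  have hF : ∀ x y, q x = q y → ∑ j, groupConv (f j) (f j) x - doublesPlusCard b x =
      ∑ j, groupConv (f j) (f j) y - doublesPlusCard b y := by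
    refine (hker fun g => ∑ j, groupConv (f j) (f j) g - doublesPlusCard b g).1 ?_
    rw [charSum_sub, charSum_sum, charSum_doublesPlusCard, ← hsum, sub_eq_zero]
    exact Finset.sum_congr rfl fun j _ => by rw [charSum_groupConv, sq]
  obtain ⟨k, hk, hk0⟩ : ∃ k, q k = 0 ∧ k ≠ 0 := by
    rw [← hfib 0] at hp
    obtain ⟨k, hk, hk0⟩ := Finset.exists_mem_ne hp 0
    exact ⟨k, (Finset.mem_filter.1 hk).2, hk0⟩
  choose J hJ using exists_fiberCharSum_ne_zero hker hk hk0 h2G h2Q hb hb0 hF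
  set S : Finset (Fin r × Q) :=
    Finset.univ.filter fun x => fiberCharSum q e (f x.1) x.2 ≠ 0 with hS
  -- Each pair in S uses at least 2(p - 1) of the total variance 2(p - 1)|ι|.
  have hcard : S.card ≤ Fintype.card ι := by
    have h1 := sum_sum_sq_sub_eq hker hfib (fun i h => hb0 i (h2Q _ h)) hreal hsum
    have h2 : ∑ x ∈ S, 2 * ((p : ℤ) - 1) ≤
        ∑ j, ∑ x, ∑ y with q y = q x, (f j x - f j y) ^ 2 := by
      have h3 : ∀ j, ∑ x, ∑ y with q y = q x, (f j x - f j y) ^ 2 =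
          ∑ C, ∑ x with q x = C, ∑ y with q y = C, (f j x - f j y) ^ 2 := by
        intro j
        rw [← Finset.sum_fiberwise Finset.univ q]
        refine Finset.sum_congr rfl fun C _ => Finset.sum_congr rfl fun x hx => ?_
        rw [(Finset.mem_filter.1 hx).2]
      simp only [h3]
      rw [← Fintype.sum_prod_type' (f := fun j C =>
        ∑ x with q x = C, ∑ y with q y = C, (f j x - f j y) ^ 2)]
      refine (Finset.sum_le_sum fun x hx => ?_).trans
        (Finset.sum_le_sum_of_subset_of_nonneg (Finset.subset_univ S) fun x _ _ =>
          Finset.sum_nonneg fun _ _ => Finset.sum_nonneg fun _ _ => sq_nonneg _)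
      have hx := (Finset.mem_filter.1 hx).2
      rw [Ne, fiberCharSum_eq_zero_iff hker] at hx
      push Not at hx
      obtain ⟨u, v, hu, hv, huv⟩ := hx
      have := two_mul_card_sub_one_le_sum_sq (Finset.univ.filter fun g => q g = x.2) (f x.1)
        (a := u) (b := v) (by simpa) (by simpa) huv
      rwa [hfib] at this
    rw [h1, Finset.sum_const, nsmul_eq_mul] at h2
    have hp' : (0 : ℤ) < 2 * ((p : ℤ) - 1) := by
      have : (1 : ℤ) < p := by exact_mod_cast hp
      linarith
    have : (S.card : ℤ) ≤ Fintype.card ι := le_of_mul_le_mul_right (by linarith) hp'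
    exact_mod_cast this
  -- An injection from ι into a set of at most |ι| elements is onto.
  have himage : Finset.univ.image (fun i => (J i, q (b i))) = S := by
    refine Finset.eq_of_subset_of_card_le ?_ ?_
    · intro x hx
      obtain ⟨i, -, rfl⟩ := Finset.mem_image.1 hx
      simpa [hS] using hJ i
    · rw [Finset.card_image_of_injective _ fun i i' h => hb (congrArg Prod.snd h)]
      simpa using hcard
  have hsupp : ∀ j C, fiberCharSum q e (f j) C ≠ 0 → ∃ i, J i = j ∧ q (b i) = C := by
    intro j C h
    have : (j, C) ∈ S := by simpa [hS] using h
    rw [← himage] at this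
    simpa using this
  refine ⟨J, fun i i' hne hne0 hdis hJJ => ?_⟩
  -- This is the component over q(b i) + q(b i'), a fibre containing neither 0 nor any double 2b_l.
  -- Only the pairs at i and i' contribute to it, with equal products.
  have hzero : ∑ x : Fin r × Q, fiberCharSum q e (f x.1) x.2 *
      fiberCharSum q e (f x.1) (q (b i) + q (b i') - x.2) = 0 := by
    rw [Fintype.sum_prod_type' (f := fun j C => fiberCharSum q e (f j) C *
      fiberCharSum q e (f j) (q (b i) + q (b i') - C))]
    simp only [← fiberCharSum_groupConv]
    have h1 : ∑ j, fiberCharSum q e (groupConv (f j) (f j)) (q (b i) + q (b i')) =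
        fiberCharSum q e (fun g => ∑ j, groupConv (f j) (f j) g) (q (b i) + q (b i')) := by
      simp only [fiberCharSum, ← charSum_sum]
      congr 1
      ext g
      split_ifs <;> simp
    rw [h1, fiberCharSum_eq_zero_iff hker]
    have h2 : ∀ x, q x = q (b i) + q (b i') → doublesPlusCard b x = 0 := by
      intro x hx
      refine doublesPlusCard_eq_zero (fun h => hne0 (by rw [← hx, h, map_zero])) fun l h => ?_
      rcases hdis l l (by rw [← hx, h, map_add]) with ⟨h1, h2⟩ | ⟨h1, h2⟩
      · exact hne (h1.symm.trans h2)
      · exact hne (h2.symm.trans h1)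
    intro x y hx hy
    simpa [h2 x hx, h2 y hy] using hF x y (hx.trans hy.symm)
  rw [Finset.sum_eq_add (J i, q (b i)) (J i', q (b i')) (fun h => hne (hb (congrArg Prod.snd h)))
    ?_ (by simp) (by simp)] at hzero
  · simp only [add_sub_cancel_left, add_sub_cancel_right] at hzero
    rw [← hJJ, mul_comm, ← two_mul] at hzero
    have h1 := hJ i
    have h2 := hJ i'
    rw [← hJJ] at h2
    simp [h1, h2] at hzero
  · rintro ⟨j, C⟩ - ⟨hi, hi'⟩
    by_contra hcon
    obtain ⟨l, hl, hlC⟩ := hsupp _ _ (left_ne_zero_of_mul hcon)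
    obtain ⟨l', hl', hlC'⟩ := hsupp _ _ (right_ne_zero_of_mul hcon)
    simp only at hl hlC hl' hlC'
    rcases hdis l l' (by rw [hlC, hlC']; abel) with ⟨rfl, -⟩ | ⟨rfl, -⟩
    · exact hi (by rw [hl, hlC])
    · exact hi' (by rw [hl, hlC])

end Representations

/-! ### The kernel of evaluation at a root of unity of prime power order -/

section PrimePowerCharacters

theorem isPrimitiveRoot_zetaRoot {N : ℕ} (hN : N ≠ 0) : IsPrimitiveRoot (zetaRoot N) N :=
  Complex.isPrimitiveRoot_exp N hN

theorem zetaRoot_ne_zero (N : ℕ) : zetaRoot N ≠ 0 := Complex.exp_ne_zero _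

theorem zetaRoot_mul_pow {M N : ℕ} (hM : M ≠ 0) : zetaRoot (M * N) ^ M = zetaRoot N := by
  have : (M : ℂ) ≠ 0 := by exact_mod_cast hM
  unfold zetaRoot
  rw [← Complex.exp_nat_mul]
  congr 1
  rw [Nat.cast_mul]
  field_simp

theorem stdAddChar_natCast {N : ℕ} [NeZero N] (j : ℕ) :
    ZMod.stdAddChar (j : ZMod N) = zetaRoot N ^ j := by
  have := ZMod.stdAddChar_coe (N := N) (j : ℤ)
  rw [Int.cast_natCast] at this
  rw [this, zetaRoot, ← Complex.exp_nat_mul]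
  congr 1
  push_cast
  ring

theorem stdAddChar_eq_zetaRoot_pow_val {N : ℕ} [NeZero N] (g : ZMod N) :
    ZMod.stdAddChar g = zetaRoot N ^ g.val := by
  conv_lhs => rw [← ZMod.natCast_zmod_val g]
  exact stdAddChar_natCast _

/-- Integral group ring elements of small degree are determined by their value at a primitive root
of unity. -/
theorem eq_zero_of_charSum_stdAddChar_eq_zero {N : ℕ} [NeZero N] (f : ZMod N → ℤ)
    (hf : charSum ZMod.stdAddChar f = 0) (hdeg : ∀ g : ZMod N, N.totient ≤ g.val → f g = 0) :
    f = 0 := by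
  have hN : N ≠ 0 := NeZero.ne N
  set P : Polynomial ℚ := ∑ g : ZMod N, Polynomial.monomial g.val (f g : ℚ) with hP
  have hcoeff : ∀ g : ZMod N, P.coeff g.val = f g := by
    intro g
    simp only [hP, Polynomial.finsetSum_coeff, Polynomial.coeff_monomial,
      (ZMod.val_injective N).eq_iff]
    simp
  have hroot : Polynomial.aeval (zetaRoot N) P = 0 := by
    rw [← hf, hP, map_sum, charSum]
    refine Finset.sum_congr rfl fun g _ => ?_
    rw [Polynomial.aeval_monomial, stdAddChar_eq_zetaRoot_pow_val]
    simp
  have hPdeg : P.degree < (N.totient : ℕ) := by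
    rw [Polynomial.degree_lt_iff_coeff_zero]
    intro m hm
    simp only [hP, Polynomial.finsetSum_coeff, Polynomial.coeff_monomial]
    refine Finset.sum_eq_zero fun g _ => ?_
    split_ifs with h
    · rw [hdeg g (h ▸ hm), Int.cast_zero]
    · rfl
  have hP0 : P = 0 := by
    by_contra h
    have h1 := minpoly.degree_le_of_ne_zero ℚ (zetaRoot N) h hroot
    rw [← Polynomial.cyclotomic_eq_minpoly_rat (isPrimitiveRoot_zetaRoot hN)
      (Nat.pos_of_ne_zero hN), Polynomial.degree_cyclotomic] at h1
    exact absurd hPdeg (not_lt.2 h1)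
  ext g
  have := hcoeff g
  rw [hP0, Polynomial.coeff_zero] at this
  exact_mod_cast this.symm

variable (p s : ℕ)

/-- The reduction map on residue classes modulo powers of `p`. -/
def primePowReduction : ZMod (p ^ (s + 1)) →+ ZMod (p ^ s) :=
  (ZMod.castHom (pow_dvd_pow p s.le_succ) (ZMod (p ^ s))).toAddMonoidHom

theorem primePowReduction_intCast (k : ℤ) :
    primePowReduction p s (k : ZMod (p ^ (s + 1))) = k :=
  map_intCast (ZMod.castHom (pow_dvd_pow p s.le_succ) (ZMod (p ^ s))) k

theorem primePowReduction_natCast (k : ℕ) :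
    primePowReduction p s (k : ZMod (p ^ (s + 1))) = k :=
  map_natCast (ZMod.castHom (pow_dvd_pow p s.le_succ) (ZMod (p ^ s))) k

variable [Fact p.Prime]

theorem card_fiber_primePowReduction (C : ZMod (p ^ s)) :
    (Finset.univ.filter fun g => primePowReduction p s g = C).card = p := by
  have hp : p.Prime := Fact.out
  have hsurj : ∀ D, D ∈ Set.range (primePowReduction p s) := fun D =>
    ⟨(D.val : ℕ), by rw [primePowReduction_natCast, ZMod.natCast_zmod_val]⟩
  have h := Finset.card_eq_sum_card_fiberwise (s := Finset.univ)
    (f := primePowReduction p s) (t := Finset.univ) (fun _ _ => Finset.mem_univ _)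
  rw [Finset.sum_congr rfl fun D _ =>
    AddMonoidHom.card_fiber_eq_of_mem_range (primePowReduction p s) (hsurj D) (hsurj C)] at h
  rw [Finset.sum_const, Finset.card_univ, Finset.card_univ, ZMod.card, ZMod.card,
    smul_eq_mul] at h
  exact Nat.eq_of_mul_eq_mul_left (pow_pos hp.pos s) (h.symm.trans (pow_succ p s))

/-- Translation by p^s, an element of ker q, preserves f but multiplies its character sum by a root
of unity other than 1. -/
theorem charSum_stdAddChar_eq_zero_of_factorsThrough (f : ZMod (p ^ (s + 1)) → ℤ)
    (hf : ∀ x y, primePowReduction p s x = primePowReduction p s y → f x = f y) :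
    charSum ZMod.stdAddChar f = 0 := by
  have hp : p.Prime := Fact.out
  set k : ZMod (p ^ (s + 1)) := ((p ^ s : ℕ) : ZMod (p ^ (s + 1))) with hk
  have hqk : primePowReduction p s k = 0 := by
    rw [hk, primePowReduction_natCast, ZMod.natCast_self]
  have hk0 : k ≠ 0 := by
    rw [hk, Ne, ZMod.natCast_eq_zero_iff, Nat.pow_dvd_pow_iff_le_right hp.one_lt]
    omega
  have he : ZMod.stdAddChar k ≠ 1 := by
    rw [← (ZMod.stdAddChar (N := p ^ (s + 1))).map_zero_eq_one]
    exact fun h => hk0 (ZMod.injective_stdAddChar h)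
  have h : charSum ZMod.stdAddChar f = ZMod.stdAddChar k * charSum ZMod.stdAddChar f := by
    conv_lhs => rw [charSum, ← Equiv.sum_comp (Equiv.addLeft k)]
    rw [charSum, Finset.mul_sum]
    refine Finset.sum_congr rfl fun g _ => ?_
    rw [Equiv.coe_addLeft, AddChar.map_add_eq_mul, hf (k + g) g (by rw [map_add, hqk, zero_add])]
    ring
  have h1 : (ZMod.stdAddChar k - 1) * charSum ZMod.stdAddChar f = 0 := by
    rw [sub_mul, one_mul, ← h, sub_self]
  exact (mul_eq_zero.1 h1).resolve_left (sub_ne_zero.2 he)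

theorem charSum_stdAddChar_eq_zero_iff (f : ZMod (p ^ (s + 1)) → ℤ) :
    charSum ZMod.stdAddChar f = 0 ↔
      ∀ x y, primePowReduction p s x = primePowReduction p s y → f x = f y := by
  have hp : p.Prime := Fact.out
  refine ⟨fun hf => ?_, charSum_stdAddChar_eq_zero_of_factorsThrough p s f⟩
  -- The top representative of each fibre, of degree at least φ(p^(s+1)) = p^s(p - 1). Subtracting
  -- its value along the fibre leaves a polynomial of degree below φ(p^(s+1)).
  set r : ZMod (p ^ s) → ZMod (p ^ (s + 1)) := fun C => ((C.val + p ^ s * (p - 1) : ℕ) :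
    ZMod (p ^ (s + 1))) with hr
  have hzero : (fun g => f g - f (r (primePowReduction p s g))) = 0 := by
    refine eq_zero_of_charSum_stdAddChar_eq_zero _ ?_ fun g hg => ?_
    · rw [charSum_sub, hf, charSum_stdAddChar_eq_zero_of_factorsThrough p s
        (fun g => f (r (primePowReduction p s g))) (fun x y h => by rw [h]), sub_zero]
    · rw [Nat.totient_prime_pow_succ hp] at hg
      obtain ⟨t, ht⟩ := Nat.exists_eq_add_of_le' hg
      have hlt : t < p ^ s := by
        have h1 := g.val_lt
        have h2 : p ^ s * (p - 1) + p ^ s = p ^ (s + 1) := by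
          rw [← Nat.mul_succ, Nat.succ_eq_add_one, Nat.sub_add_cancel hp.one_le, pow_succ]
        omega
      have hg' : g = ((t + p ^ s * (p - 1) : ℕ) : ZMod (p ^ (s + 1))) := by
        rw [← ht, ZMod.natCast_zmod_val]
      have hq : primePowReduction p s g = (t : ZMod (p ^ s)) := by
        rw [hg', primePowReduction_natCast]
        push_cast
        rw [← Nat.cast_pow, ZMod.natCast_self, zero_mul, add_zero]
      rw [sub_eq_zero, hq, hr]
      simp only [ZMod.val_natCast_of_lt hlt]
      rw [← hg']
  intro x y h
  have hx := congrFun hzero x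
  have hy := congrFun hzero y
  simp only [Pi.zero_apply, sub_eq_zero] at hx hy
  rw [hx, hy, h]

end PrimePowerCharacters

/-! ### Integers of the real cyclotomic fields -/

section IntegralElements

theorem exists_charSum_of_mem_adjoin {N : ℕ} [NeZero N] {y : ℂ}
    (hy : y ∈ Algebra.adjoin ℤ {zetaRoot N}) :
    ∃ f : ZMod N → ℤ, charSum ZMod.stdAddChar f = y := by
  induction hy using Algebra.adjoin_induction with
  | mem x hx =>
    refine ⟨fun g => if g = (1 : ℕ) then 1 else 0, ?_⟩
    rw [charSum_ite_eq, stdAddChar_natCast, pow_one, Set.mem_singleton_iff.1 hx]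
  | algebraMap n =>
    refine ⟨fun g => n * if g = 0 then 1 else 0, ?_⟩
    simp [charSum]
  | add x y _ _ hx hy =>
    obtain ⟨f, rfl⟩ := hx
    obtain ⟨f', rfl⟩ := hy
    exact ⟨_, charSum_add _ f f'⟩
  | mul x y _ _ hx hy =>
    obtain ⟨f, rfl⟩ := hx
    obtain ⟨f', rfl⟩ := hy
    exact ⟨_, charSum_groupConv _ f f'⟩

/-- The ring of integers of the p^k-th cyclotomic field is ℤ[ζ]; this supplies integral lifts to the
group ring. -/
theorem mem_adjoin_int_of_isIntegral {p k : ℕ} [Fact p.Prime] {y : ℂ} (hy : IsIntegral ℤ y)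
    (hmem : y ∈ IntermediateField.adjoin ℚ {zetaRoot (p ^ k)}) :
    y ∈ Algebra.adjoin ℤ {zetaRoot (p ^ k)} := by
  have hζ : IsPrimitiveRoot (zetaRoot (p ^ k)) (p ^ k) := isPrimitiveRoot_zetaRoot (NeZero.ne _)
  have hint : IsIntegral ℚ (zetaRoot (p ^ k)) := hζ.isIntegral (NeZero.pos _) |>.tower_top
  set K := IntermediateField.adjoin ℚ {zetaRoot (p ^ k)} with hK
  have hcyc : IsCyclotomicExtension {p ^ k} ℚ K := by
    change IsCyclotomicExtension {p ^ k} ℚ K.toSubalgebra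
    rw [hK, IntermediateField.adjoin_simple_toSubalgebra_of_isAlgebraic hint.isAlgebraic]
    exact hζ.adjoin_isCyclotomicExtension ℚ
  set z : K := ⟨zetaRoot (p ^ k), IntermediateField.mem_adjoin_simple_self ℚ _⟩ with hz
  have hzp : IsPrimitiveRoot z (p ^ k) :=
    IsPrimitiveRoot.of_map_of_injective (f := K.val) hζ K.val.injective
  have hcl := IsCyclotomicExtension.Rat.isIntegralClosure_adjoin_singleton_of_prime_pow hzp
  have hy' : IsIntegral ℤ (⟨y, hmem⟩ : K) :=
    (isIntegral_algHom_iff (K.val.restrictScalars ℤ) K.val.injective).1 hy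
  obtain ⟨w, hw⟩ := hcl.isIntegral_iff.1 hy'
  have hwmem : (w : K) ∈ Algebra.adjoin ℤ {z} := w.2
  have hmap := (Subalgebra.mem_map (f := K.val.restrictScalars ℤ)).2 ⟨_, hwmem, rfl⟩
  rw [AlgHom.map_adjoin, Set.image_singleton] at hmap
  have hwy : (w : K) = ⟨y, hmem⟩ := hw
  rw [hwy] at hmap
  exact hmap

theorem conj_eq_self_of_mem_realCyclotomicField {N : ℕ} {y : ℂ}
    (hy : y ∈ realCyclotomicField N) : (starRingEnd ℂ) y = y := by
  induction hy using IntermediateField.adjoin_induction with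
  | mem x hx =>
    have h : (starRingEnd ℂ) (zetaRoot N) = (zetaRoot N)⁻¹ := by
      rw [zetaRoot, ← Complex.exp_conj, ← Complex.exp_neg]
      congr 1
      simp [neg_div, map_ofNat]
    rw [Set.mem_singleton_iff.1 hx, map_add, map_inv₀, h, inv_inv, add_comm]
  | algebraMap x => simp
  | add x y _ _ hx hy => rw [map_add, hx, hy]
  | inv x _ hx => rw [map_inv₀, hx]
  | mul x y _ _ hx hy => rw [map_mul, hx, hy]

theorem realCyclotomicField_le_adjoin (N : ℕ) :
    realCyclotomicField N ≤ IntermediateField.adjoin ℚ {zetaRoot N} := by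
  rw [realCyclotomicField, IntermediateField.adjoin_le_iff, Set.singleton_subset_iff]
  have := IntermediateField.mem_adjoin_simple_self ℚ (zetaRoot N)
  exact add_mem this (inv_mem this)

theorem zetaRoot_pow_add_inv_mem (N c : ℕ) :
    zetaRoot N ^ c + (zetaRoot N ^ c)⁻¹ ∈ realCyclotomicField N := by
  have h0 : zetaRoot N * (zetaRoot N)⁻¹ = 1 := mul_inv_cancel₀ (zetaRoot_ne_zero N)
  have hd : Polynomial.dickson 1 (1 : ℂ) c =
      (Polynomial.dickson 1 (1 : ℚ) c).map (algebraMap ℚ ℂ) := by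
    rw [Polynomial.map_dickson, map_one]
  rw [← inv_pow, ← Polynomial.dickson_one_one_eval_add_inv _ _ h0 c, hd,
    Polynomial.eval_map_algebraMap]
  exact IntermediateField.algebra_adjoin_le_adjoin _ _ (Polynomial.aeval_mem_adjoin_singleton ℚ _)

theorem isIntegral_zetaRoot_pow_add_inv {N : ℕ} (hN : N ≠ 0) (c : ℕ) :
    IsIntegral ℤ (zetaRoot N ^ c + (zetaRoot N ^ c)⁻¹) := by
  have h := (isPrimitiveRoot_zetaRoot hN)
  rw [← inv_pow]
  exact ((h.isIntegral (Nat.pos_of_ne_zero hN)).pow c).add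
    ((h.inv.isIntegral (Nat.pos_of_ne_zero hN)).pow c)

end IntegralElements

/-! ### The lower bound on the number of squares, and passage to the tower -/

section SumsOfSquares

/-- Up to order, a sum of two distinct terms of a rapidly growing sequence is not a sum of two other
signed terms. -/
theorem signed_pair_sum_unique {n : ℕ} {w : Fin n → ℤ} (hpos : ∀ i, 0 < w i)
    (hgrow : ∀ i j, i < j → 4 * w i < w j) {i i' : Fin n} (hne : i ≠ i') (k l : Fin n × Bool)
    (h : (if k.2 then w k.1 else -w k.1) + (if l.2 then w l.1 else -w l.1) = w i + w i') :
    (k = (i, true) ∧ l = (i', true)) ∨ (k = (i', true) ∧ l = (i, true)) := by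
  obtain ⟨k, ε⟩ := k
  obtain ⟨l, δ⟩ := l
  have hcmp : ∀ a b, (a = b ∧ w a = w b) ∨ 4 * w a < w b ∨ 4 * w b < w a := by
    intro a b
    rcases lt_trichotomy a b with h | h | h
    · exact Or.inr (Or.inl (hgrow _ _ h))
    · exact Or.inl ⟨h, by rw [h]⟩
    · exact Or.inr (Or.inr (hgrow _ _ h))
  have h1 := hpos i
  have h2 := hpos i'
  have h3 := hpos k
  have h4 := hpos l
  have hii : 4 * w i < w i' ∨ 4 * w i' < w i := (hcmp i i').resolve_left fun h => hne h.1
  -- Any two terms are equal or differ by a factor above 4, so linear arithmetic settles every sign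
  -- pattern.
  have hmain : (w k = w i ∧ w l = w i' ∧ ε = true ∧ δ = true) ∨
      (w k = w i' ∧ w l = w i ∧ ε = true ∧ δ = true) := by
    have e1 := (hcmp k i).imp_left And.right
    have e2 := (hcmp k i').imp_left And.right
    have e3 := (hcmp l i).imp_left And.right
    have e4 := (hcmp l i').imp_left And.right
    have e5 := (hcmp k l).imp_left And.right
    cases ε <;> cases δ <;> simp at h ⊢ <;> omega
  have hinj : ∀ a b, w a = w b → a = b := by
    intro a b hab
    have := hpos a
    rcases hcmp a b with h | h | h
    · exact h.1
    · omega
    · omega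
  rcases hmain with ⟨a, b, rfl, rfl⟩ | ⟨a, b, rfl, rfl⟩
  · exact Or.inl ⟨by rw [hinj _ _ a], by rw [hinj _ _ b]⟩
  · exact Or.inr ⟨by rw [hinj _ _ a], by rw [hinj _ _ b]⟩

theorem card_le_of_sum_sq_eq {p s n r : ℕ} (hp : p.Prime) (hodd : Odd p) {w : Fin n → ℕ}
    (hpos : ∀ i, 0 < w i) (hgrow : ∀ i j, i < j → 4 * w i < w j) (hlt : ∀ i, 4 * w i < p ^ s)
    {y : Fin r → ℂ} (hint : ∀ j, IsIntegral ℤ (y j))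
    (hreal : ∀ j, y j ∈ realCyclotomicField (p ^ (s + 1)))
    (hsum : ∑ i, (zetaRoot (p ^ (s + 1)) ^ w i + (zetaRoot (p ^ (s + 1)) ^ w i)⁻¹) ^ 2 =
      ∑ j, y j ^ 2) : n ≤ r := by
  have : Fact p.Prime := ⟨hp⟩
  set q := primePowReduction p s
  choose f hf using fun j => exists_charSum_of_mem_adjoin
    (mem_adjoin_int_of_isIntegral (hint j) (realCyclotomicField_le_adjoin _ (hreal j)))
  set v : Fin n × Bool → ℤ := fun k => if k.2 then (w k.1 : ℤ) else -(w k.1 : ℤ) with hv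
  set b : Fin n × Bool → ZMod (p ^ (s + 1)) := fun k => (v k : ZMod (p ^ (s + 1))) with hb
  have hqb : ∀ k, q (b k) = (v k : ZMod (p ^ s)) := fun k => primePowReduction_intCast p s _
  have hvlt : ∀ k, 4 * |v k| < (p ^ s : ℕ) := by
    rintro ⟨k, ε⟩
    have := hlt k
    cases ε <;> simp only [hv] <;> simp <;> exact_mod_cast this
  -- Since 4|v| < p^s, a congruence modulo p^s between sums of at most two signed exponents is an
  -- equality of integers.
  have hcast : ∀ a c : ℤ, (a : ZMod (p ^ s)) = c → |c - a| < (p ^ s : ℕ) → a = c := by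
    intro a c h hac
    rw [ZMod.intCast_eq_intCast_iff_dvd_sub] at h
    have := Int.eq_zero_of_abs_lt_dvd h hac
    omega
  have hinj : Function.Injective fun k => q (b k) := by
    intro k l h
    simp only [hqb] at h
    have hkl := hcast _ _ h (by
      have := hvlt k
      have := hvlt l
      have := abs_sub (v l) (v k)
      have := abs_nonneg (v l)
      have := abs_nonneg (v k)
      omega)
    obtain ⟨k, ε⟩ := k
    obtain ⟨l, δ⟩ := l
    have h1 := hpos k
    have h2 := hpos l
    rcases lt_trichotomy k l with h3 | rfl | h3
    · have := hgrow _ _ h3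
      cases ε <;> cases δ <;> simp [hv] at hkl <;> omega
    · cases ε <;> cases δ <;> simp [hv] at hkl ⊢ <;> omega
    · have := hgrow _ _ h3
      cases ε <;> cases δ <;> simp [hv] at hkl <;> omega
  have hb0 : ∀ k, q (b k) ≠ 0 := by
    intro k h
    rw [hqb, ← Int.cast_zero] at h
    have h0 := hcast _ _ h (by
      have := hvlt k
      have := abs_nonneg (v k)
      rw [zero_sub, abs_neg]
      omega)
    obtain ⟨k, ε⟩ := k
    have h1 := hpos k
    cases ε <;> simp [hv] at h0 <;> omega
  have hdouble : ∀ t, ∀ g : ZMod (p ^ t), g + g = 0 → g = 0 := fun t g =>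
    (ZMod.add_self_eq_zero_iff_eq_zero hodd.pow).1
  have hsum' : ∑ j, charSum ZMod.stdAddChar (f j) ^ 2 =
      ∑ k, (ZMod.stdAddChar (b k) ^ 2 + 1) := by
    simp only [hf]
    rw [← hsum, Fintype.sum_prod_type]
    refine Finset.sum_congr rfl fun i _ => ?_
    simp only [Fintype.sum_bool, hb, hv, if_true, Bool.false_eq_true, if_false, Int.cast_neg,
      Int.cast_natCast, AddChar.map_neg_eq_inv, stdAddChar_natCast]
    have := zetaRoot_ne_zero (p ^ (s + 1))
    field_simp
    ring
  obtain ⟨J, hJ⟩ := exists_separating_map (charSum_stdAddChar_eq_zero_iff p s)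
    (card_fiber_primePowReduction p s) hp.one_lt (hdouble _) (hdouble _) hinj hb0
    (fun j => by rw [hf, conj_eq_self_of_mem_realCyclotomicField (hreal j)]) hsum'
  have hJinj : Function.Injective fun i : Fin n => J (i, true) := by
    intro i i' h
    by_contra hne
    refine hJ (i, true) (i', true) (by simpa using hne) ?_ (fun k l hkl => ?_) h
    · intro h0
      rw [hqb, hqb, ← Int.cast_add, ← Int.cast_zero] at h0
      have h1 := hpos i
      have h2 := hlt i
      have h3 := hlt i'
      have := hcast _ _ h0 (by
        simp only [hv, if_true, zero_sub, abs_neg]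
        rw [abs_of_nonneg (by positivity)]
        omega)
      simp only [hv, if_true] at this
      omega
    · change q (b k) + q (b l) = q (b (i, true)) + q (b (i', true)) at hkl
      rw [hqb, hqb, hqb, hqb, ← Int.cast_add, ← Int.cast_add] at hkl
      have := hcast _ _ hkl (by
        have h1 := hvlt k
        have h2 := hvlt l
        have h3 := hvlt (i, true)
        have h4 := hvlt (i', true)
        have := abs_sub (v (i, true) + v (i', true)) (v k + v l)
        have := abs_add_le (v (i, true)) (v (i', true))
        have := abs_add_le (v k) (v l)
        omega)
      exact signed_pair_sum_unique (w := fun i => (w i : ℤ)) (fun i => by exact_mod_cast hpos i)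
        (fun i j hij => by exact_mod_cast hgrow i j hij) hne k l (by simpa [hv] using this)
  simpa using Fintype.card_le_of_injective _ hJinj

theorem mem_realCyclotomicTower_iff {p : ℕ} (hp : p ≠ 0) {y : ℂ} :
    y ∈ realCyclotomicTower p ↔ ∃ n, y ∈ realCyclotomicField (p ^ n) := by
  rw [← SetLike.mem_coe, coe_realCyclotomicTower p hp, Set.mem_iUnion]
  rfl

theorem sumsOfSquares_realCyclotomicTower_ne {p : ℕ} (hp : p.Prime) (hodd : Odd p) (n : ℕ) :
    sumsOfSquares (𝓞 (realCyclotomicTower p)) n ≠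
      sumsOfSquares (𝓞 (realCyclotomicTower p)) (n + 1) := by
  intro heq
  -- With t < p^t this gives 4 * 5^i < p^t for every exponent 5^i.
  set t := 4 * 5 ^ (n + 1) with ht
  have hp0 := hp.ne_zero
  set x : Fin (n + 1) → 𝓞 (realCyclotomicTower p) := fun i =>
    ⟨⟨zetaRoot (p ^ (t + 1)) ^ 5 ^ (i : ℕ) + (zetaRoot (p ^ (t + 1)) ^ 5 ^ (i : ℕ))⁻¹,
      (mem_realCyclotomicTower_iff hp0).2 ⟨t + 1, zetaRoot_pow_add_inv_mem _ _⟩⟩,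
      (isIntegral_algHom_iff ((realCyclotomicTower p).val.restrictScalars ℤ)
        (realCyclotomicTower p).val.injective).1
        (isIntegral_zetaRoot_pow_add_inv (pow_ne_zero _ hp0) _)⟩ with hx
  obtain ⟨y, hy⟩ : ∑ i, x i ^ 2 ∈ sumsOfSquares (𝓞 (realCyclotomicTower p)) n :=
    heq ▸ ⟨x, rfl⟩
  set φ : 𝓞 (realCyclotomicTower p) →+* ℂ := (realCyclotomicTower p).val.toRingHom.comp
    (algebraMap (𝓞 (realCyclotomicTower p)) (realCyclotomicTower p)) with hφ
  have hyC := congrArg φ hy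
  simp only [map_sum, map_pow] at hyC
  choose m hm using fun j =>
    (mem_realCyclotomicTower_iff hp0).1 (y j : realCyclotomicTower p).2
  obtain ⟨M, hM⟩ := Finset.exists_le (Finset.univ.image m)
  -- The y_j may need a higher level than the x_i. Moving up by M levels scales the exponents by
  -- p^M, preserving both growth and the size bound.
  have hx' : ∀ i, φ (x i) = zetaRoot (p ^ (t + M + 1)) ^ (p ^ M * 5 ^ (i : ℕ)) +
      (zetaRoot (p ^ (t + M + 1)) ^ (p ^ M * 5 ^ (i : ℕ)))⁻¹ := by
    intro i
    have : p ^ (t + M + 1) = p ^ M * p ^ (t + 1) := by ring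
    rw [pow_mul, this, zetaRoot_mul_pow (pow_ne_zero _ hp0)]
    rfl
  simp only [hx'] at hyC
  have hpM : 0 < p ^ M := pow_pos hp.pos M
  have := card_le_of_sum_sq_eq hp hodd (w := fun i : Fin (n + 1) => p ^ M * 5 ^ (i : ℕ))
    (fun i => by positivity)
    (fun i j hij => by
      have h1 : 5 ^ ((i : ℕ) + 1) ≤ 5 ^ (j : ℕ) := Nat.pow_le_pow_right (by norm_num) hij
      have h2 : 0 < 5 ^ (i : ℕ) := by positivity
      have h3 : 4 * 5 ^ (i : ℕ) < 5 ^ (j : ℕ) := by rw [pow_succ] at h1; omega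
      calc 4 * (p ^ M * 5 ^ (i : ℕ)) = p ^ M * (4 * 5 ^ (i : ℕ)) := by ring
        _ < p ^ M * 5 ^ (j : ℕ) := Nat.mul_lt_mul_of_pos_left h3 hpM)
    (fun i => by
      have h1 : 5 ^ (i : ℕ) ≤ 5 ^ (n + 1) := Nat.pow_le_pow_right (by norm_num) i.2.le
      have h2 : t < p ^ t := Nat.lt_pow_self hp.one_lt
      have h3 : 4 * 5 ^ (i : ℕ) < p ^ t := by omega
      calc 4 * (p ^ M * 5 ^ (i : ℕ)) = p ^ M * (4 * 5 ^ (i : ℕ)) := by ring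
        _ < p ^ M * p ^ t := Nat.mul_lt_mul_of_pos_left h3 hpM
        _ = p ^ (t + M) := by ring)
    (y := fun j => φ (y j))
    (fun j => (NumberField.RingOfIntegers.isIntegral_coe (y j)).map
      ((realCyclotomicTower p).val.restrictScalars ℤ))
    (fun j => realCyclotomicField_mono_pow p hp0
      ((hM _ (Finset.mem_image_of_mem m (Finset.mem_univ j))).trans (by omega)) (hm j))
    hyC
  omega

end SumsOfSquares

theorem theorem1p2 (p : ℕ) (hp : p.Prime) (hp4 : p ≡ 1 [MOD 4]) :
    pythagorasNumber (𝓞 (realCyclotomicTower p)) = ⊤ := by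
  have hodd : Odd p := by
    rw [Nat.odd_iff]
    have : p % 4 = 1 := hp4
    omega
  refine sInf_eq_top.2 ?_
  rintro _ ⟨n, -, hn⟩
  exact absurd hn (sumsOfSquares_realCyclotomicTower_ne hp hodd n)
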